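/- **Inverses of Chebyshev polynomials.** Let $\sigma_x,\sigma_z$ be the Pauli matrices. An element of $\mathrm{SU}(2)$ is *embeddable* if it equals $e^{i\theta\sigma_x}$ with $\theta\in[0,\pi]$, and *twisted embeddable* if it equals $e^{i\varphi\sigma_z/2}e^{i\theta\sigma_x}e^{-i\varphi\sigma_z/2}$ with $\theta\in[0,\pi]$, $\varphi\in[-\pi,\pi]$. A *single-qubit $(1,1)$ gadget* $\mathfrak G$ is a finite sequence of gates acting on one qubit (no ancillae), each of which is either a query to an oracle $U\in\mathrm{SU}(2)$ or a fixed element of $\mathrm{SU}(2)$, such that the product $\mathfrak G[U]$ is twisted embeddable whenever $U$ is embeddable. Its *depth* is the number of gates and its *cost* is the number of queries to $U$. For $n\ge 0$ and $x\in[-1,1]$ put $T_{2^n}^{-1}(x)=\cos\bigl(\arccos(x)/2^n\bigr)\in[-1,1]$. This is a right-inverse of the Chebyshev polynomial of the first kind $T_{2^n}$, that is, $T_{2^n}\bigl(T_{2^n}^{-1}(x)\bigr)=x$ for all $x\in[-1,1]$. There is an absolute constant $C>0$ such that for all integers $n\ge 0$ and all real $0<\delta\le 1$ and $0<\varepsilon\le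 1/2$ there is a single-qubit $(1,1)$ gadget $\mathfrak G$, of depth and of cost at most $C\,\delta^{-1}\log\bigl(\varepsilon^{-2}\delta^{-1/4}\bigr)$, that $\varepsilon$-approximately achieves $T_{2^n}^{-1}$ on $[-1+\delta,1-\delta]$: for every $x\in[-1+\delta,1-\delta]$, with $U_x=e^{i\arccos(x)\sigma_x}$, $$\bigl|\langle 0|\,\mathfrak G[U_x]\,|0\rangle-T_{2^n}^{-1}(x)\bigr|\le\varepsilon\quad\text{and}\quad\bigl\|\mathfrak G[U_x]-e^{i\arccos(T_{2^n}^{-1}(x))\sigma_x}\bigr\|\le\varepsilon$$ in operator norm. -/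

import Mathlib

/-- The group `SU(2)` of special unitary single-qubit operators. -/
abbrev SU2 : Type := Matrix.specialUnitaryGroup (Fin 2) ℂ

/-- The matrix of `e^{iθσ_x} = cos θ · 1 + i sin θ · σ_x`. -/
noncomputable def rotXMatrix (θ : ℝ) : Matrix (Fin 2) (Fin 2) ℂ :=
  !![(Real.cos θ : ℂ), Complex.I * (Real.sin θ : ℂ);
     Complex.I * (Real.sin θ : ℂ), (Real.cos θ : ℂ)]

/-- The matrix of `e^{iφσ_z} = cos φ · 1 + i sin φ · σ_z`. -/
noncomputable def rotZMatrix (φ : ℝ) : Matrix (Fin 2) (Fin 2) ℂ :=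
  !![(Real.cos φ : ℂ) + Complex.I * (Real.sin φ : ℂ), 0;
     0, (Real.cos φ : ℂ) - Complex.I * (Real.sin φ : ℂ)]

theorem cos_sq_add_sin_sq_complex (θ : ℝ) :
    (Real.cos θ : ℂ) * (Real.cos θ : ℂ) + (Real.sin θ : ℂ) * (Real.sin θ : ℂ) = 1 := by
  have h := Real.cos_sq_add_sin_sq θ
  rw [pow_two, pow_two] at h
  exact_mod_cast h

theorem rotXMatrix_mem (θ : ℝ) :
    rotXMatrix θ ∈ Matrix.specialUnitaryGroup (Fin 2) ℂ := by
  have h := cos_sq_add_sin_sq_complex θ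
  have hI := Complex.I_mul_I
  rw [Matrix.mem_specialUnitaryGroup_iff]
  constructor
  · rw [Matrix.mem_unitaryGroup_iff]
    ext i j
    fin_cases i <;> fin_cases j <;>
      simp [-Complex.ofReal_cos, -Complex.ofReal_sin, rotXMatrix, Matrix.mul_apply,
        Fin.sum_univ_two, Matrix.star_apply] <;> grind
  · simp [-Complex.ofReal_cos, -Complex.ofReal_sin, rotXMatrix, Matrix.det_fin_two]
    grind

theorem rotZMatrix_mem (φ : ℝ) :
    rotZMatrix φ ∈ Matrix.specialUnitaryGroup (Fin 2) ℂ := by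
  have h := cos_sq_add_sin_sq_complex φ
  have hI := Complex.I_mul_I
  rw [Matrix.mem_specialUnitaryGroup_iff]
  constructor
  · rw [Matrix.mem_unitaryGroup_iff]
    ext i j
    fin_cases i <;> fin_cases j <;>
      simp [-Complex.ofReal_cos, -Complex.ofReal_sin, rotZMatrix, Matrix.mul_apply,
        Fin.sum_univ_two, Matrix.star_apply] <;> grind
  · simp [-Complex.ofReal_cos, -Complex.ofReal_sin, rotZMatrix, Matrix.det_fin_two]
    grind

/-- The rotation `e^{iθσ_x}`. -/
noncomputable def rotX (θ : ℝ) : SU2 := ⟨rotXMatrix θ, rotXMatrix_mem θ⟩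

/-- The rotation `e^{iφσ_z}`. -/
noncomputable def rotZ (φ : ℝ) : SU2 := ⟨rotZMatrix φ, rotZMatrix_mem φ⟩

/-- Embeddable unitaries: `e^{iθσ_x}` with `θ ∈ [0, π]`. -/
def Embeddable (U : SU2) : Prop :=
  ∃ θ ∈ Set.Icc (0 : ℝ) Real.pi, U = rotX θ

/-- Twisted embeddable unitaries: `e^{iφσ_z/2} e^{iθσ_x} e^{-iφσ_z/2}` with `θ ∈ [0, π]` and
`φ ∈ [-π, π]`. -/
def TwistedEmbeddable (U : SU2) : Prop :=
  ∃ θ ∈ Set.Icc (0 : ℝ) Real.pi, ∃ φ ∈ Set.Icc (-Real.pi) Real.pi,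
    U = rotZ (φ / 2) * rotX θ * rotZ (-(φ / 2))

/-- A gate of a single-qubit circuit with `a` input oracles: a query to one of the oracles, or a
fixed single-qubit unitary. -/
inductive Gate (a : ℕ) : Type
  | query (k : Fin a) : Gate a
  | fixed (V : SU2) : Gate a

/-- The unitary that a gate implements when the oracles are `U`. -/
noncomputable def Gate.eval {a : ℕ} (U : Fin a → SU2) : Gate a → SU2
  | .query k => U k
  | .fixed V => V

/-- `1` for a query to the `j`-th oracle, and `0` for any other gate. -/
def Gate.queryCount {a : ℕ} (j : Fin a) : Gate a → ℕ
  | .query k => if k = j then 1 else 0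
  | .fixed _ => 0

/-- A single-qubit circuit (there is no ancilla): a finite sequence of gates, all acting on the
same qubit. -/
abbrev Circuit (a : ℕ) : Type := List (Gate a)

/-- The unitary that a circuit implements: the product of its gates, from left to right. -/
noncomputable def Circuit.eval {a : ℕ} (c : Circuit a) (U : Fin a → SU2) : SU2 :=
  (c.map (Gate.eval U)).prod

/-- A superoperator taking `a` single-qubit oracles to `b` single-qubit unitaries is an `(a, b)`
gadget if it sends embeddable oracles to twisted embeddable unitaries. -/
def IsGadget {a b : ℕ} (G : (Fin a → SU2) → Fin b → SU2) : Prop :=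
  ∀ U : Fin a → SU2, (∀ j, Embeddable (U j)) → ∀ k, TwistedEmbeddable (G U k)

/-- A single-qubit `(a, b)` circuit gadget: an `(a, b)` gadget whose output unitaries are
implemented by single-qubit circuits, without ancillae, in which oracle queries are interspersed
with fixed single-qubit unitaries. -/
structure SingleQubitGadget (a b : ℕ) where
  circuit : Fin b → Circuit a
  isGadget : IsGadget (fun U k => (circuit k).eval U)

namespace SingleQubitGadget

variable {a b : ℕ}

/-- The `k`-th output unitary of the gadget on the oracles `U`. -/
noncomputable def output (G : SingleQubitGadget a b) (U : Fin a → SU2) (k : Fin b) : SU2 :=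
  (G.circuit k).eval U

/-- The cost matrix: the number of queries to the `j`-th oracle made for the `k`-th output. -/
def cost (G : SingleQubitGadget a b) (j : Fin a) (k : Fin b) : ℕ :=
  ((G.circuit k).map (Gate.queryCount j)).sum

/-- The depth: the number of gates, oracle queries and fixed unitaries alike, in the longest of
the output circuits. -/
def depth (G : SingleQubitGadget a b) : ℕ :=
  Finset.univ.sup fun k => (G.circuit k).length

/-- The output of a `(1, 1)` gadget on the oracle `e^{i arccos(x) σ_x}`, which encodes `x`. -/
noncomputable def response (G : SingleQubitGadget 1 1) (x : ℝ) : SU2 :=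
  G.output (fun _ => rotX (Real.arccos x)) 0

end SingleQubitGadget

/-- The operator norm of a `2 × 2` complex matrix, as an operator on the Hilbert space `ℂ²`. -/
noncomputable def opNorm (A : Matrix (Fin 2) (Fin 2) ℂ) : ℝ :=
  ‖Matrix.toEuclideanCLM (n := Fin 2) (𝕜 := ℂ) A‖

/-- The `(1, 1)` gadget `G` `ε`-approximately achieves the function `f` on `D`: for every
`x ∈ D`, the matrix element `⟨0|U'|0⟩` of the output `U'` on the oracle encoding `x` is `ε`-close
to `f x`. -/
def ApproxAchieves (G : SingleQubitGadget 1 1) (ε : ℝ) (f : ℝ → ℝ) (D : Set ℝ) : Prop :=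
  ∀ x ∈ D, ‖(G.response x : Matrix (Fin 2) (Fin 2) ℂ) 0 0 - (f x : ℂ)‖ ≤ ε

/-- The `(1, 1)` gadget `G` `ε`-approximates, in operator norm and on `D`, the superoperator that
takes the oracle encoding `x` to the embeddable unitary encoding `f x`. -/
def ApproxEmbeds (G : SingleQubitGadget 1 1) (ε : ℝ) (f : ℝ → ℝ) (D : Set ℝ) : Prop :=
  ∀ x ∈ D, opNorm ((G.response x : Matrix (Fin 2) (Fin 2) ℂ) -
    (rotX (Real.arccos (f x)) : Matrix (Fin 2) (Fin 2) ℂ)) ≤ ε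

/-- The function `x ↦ cos(arccos(x) / m)`: the (principal) right-inverse `T_m⁻¹` on `[-1, 1]` of
the `m`-th Chebyshev polynomial of the first kind. -/
noncomputable def chebyshevInv (m : ℕ) (x : ℝ) : ℝ :=
  Real.cos (Real.arccos x / m)

/-! Put `s = 1/(2m)` with `m = 2^n`, and `x = cos θ`. It suffices to build a circuit close to
`e^{isθσ_x}`: multiplied by its mirror image under `V ↦ σ_x Vᵀ σ_x`, it becomes close to
`e^{i(θ/m)σ_x}`. Such a product always has a real upper left entry, so it is exactly twisted
embeddable however rough the approximation (`im_mul_mirror`, `twistedEmbeddable_of_im_eq_zero`).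

In the eigenbasis of `σ_x` the task is to realize a first column `(f, g)` with `f ≈ e^{isθ}`.
Generalized quantum signal processing (`exists_circuit_column`) realizes every pair of trigonometric
polynomials with `|f|² + |g|² = 1`, using one query per degree. So `f` must approximate the phase
and satisfy `|f| ≤ 1` exactly.

Let `A` be a truncation of the power series of `cos(s·arcsin x)` and take `f = A + (i/s) dA/dy` with
`x = sin y`, up to a constant phase. The untruncated function solves `A'' + s²A = 0` in `y`, with
conserved energy `A² + (A'/s)² = 1`; truncation leaves one monomial as residual. Since all
coefficients after the first are nonpositive, the energy deficit `1 - |f|²` has nonnegative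
coefficients in `x²` (`coeff_cosArcsinDeficit_nonneg`), and Fejér–Riesz supplies `g`. The same
equation bounds the error by `8K|cos θ|^{2K}` (`norm_powerTrunc_sub_le`), uniformly in `s ≤ 1`,
which is why the final constant does not depend on `n`. -/

open Polynomial ComplexConjugate

/-! ### Columns of SU(2) and the eigenbasis of σ_x -/

/-- The element of `SU(2)` with first column `(u, v)`. -/
noncomputable def suOfColumn (u v : ℂ) (h : ‖u‖ ^ 2 + ‖v‖ ^ 2 = 1) : SU2 :=
  ⟨!![u, -conj v; v, conj u], by
    have hc : u * conj u + v * conj v = 1 := by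
      rw [Complex.mul_conj', Complex.mul_conj']
      exact_mod_cast h
    rw [Matrix.mem_specialUnitaryGroup_iff]
    constructor
    · rw [Matrix.mem_unitaryGroup_iff]
      ext i j
      fin_cases i <;> fin_cases j <;>
        simp [Matrix.mul_apply, Fin.sum_univ_two, Matrix.star_apply] <;> grind
    · simp [Matrix.det_fin_two]
      grind⟩

theorem coe_suOfColumn (u v : ℂ) (h : ‖u‖ ^ 2 + ‖v‖ ^ 2 = 1) :
    (suOfColumn u v h : Matrix (Fin 2) (Fin 2) ℂ) = !![u, -conj v; v, conj u] := rfl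

theorem SU2.apply_one_one (V : SU2) : V.1 1 1 = conj (V.1 0 0) ∧ V.1 0 1 = -conj (V.1 1 0) := by
  obtain ⟨V, hV⟩ := V
  rw [Matrix.mem_specialUnitaryGroup_iff] at hV
  obtain ⟨h1, h2⟩ := hV
  have h3 := Matrix.mem_unitaryGroup_iff'.1 h1
  have e00 := congrFun (congrFun h3 0) 0
  have e01 := congrFun (congrFun h3 0) 1
  simp only [Matrix.mul_apply, Fin.sum_univ_two, Matrix.star_apply, Matrix.one_apply_eq, ne_eq,
    zero_ne_one, not_false_eq_true, Matrix.one_apply_ne, RCLike.star_def] at e00 e01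
  rw [Matrix.det_fin_two] at h2
  constructor <;> simp only
  · linear_combination (-V 1 1) * e00 + V 1 0 * e01 + conj (V 0 0) * h2
  · linear_combination (-V 0 1) * e00 + V 0 0 * e01 - conj (V 1 0) * h2

theorem SU2.ext_of_column {V W : SU2} (h0 : V.1 0 0 = W.1 0 0) (h1 : V.1 1 0 = W.1 1 0) :
    V = W := by
  have hV := V.apply_one_one
  have hW := W.apply_one_one
  apply Subtype.ext
  ext i j
  fin_cases i <;> fin_cases j <;> simp_all

theorem SU2.normSq_column (V : SU2) : ‖V.1 0 0‖ ^ 2 + ‖V.1 1 0‖ ^ 2 = 1 := by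
  have h3 := Matrix.mem_unitaryGroup_iff'.1 (Matrix.mem_specialUnitaryGroup_iff.1 V.2).1
  have e00 := congrFun (congrFun h3 0) 0
  simp only [Matrix.mul_apply, Fin.sum_univ_two, Matrix.star_apply, Matrix.one_apply_eq,
    RCLike.star_def, Complex.conj_mul'] at e00
  exact_mod_cast e00

/-- The real rotation that diagonalizes `σ_x`. -/
noncomputable def eigenbasisX : SU2 :=
  suOfColumn (Real.sqrt 2 / 2 : ℝ) (Real.sqrt 2 / 2 : ℝ) (by
    rw [Complex.norm_real, Real.norm_eq_abs, sq_abs, div_pow, Real.sq_sqrt (by norm_num)]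
    norm_num)

theorem rotX_mul_eigenbasisX (θ : ℝ) : rotX θ * eigenbasisX = eigenbasisX * rotZ θ := by
  apply SU2.ext_of_column
  · simp [-Complex.ofReal_cos, -Complex.ofReal_sin, rotX, rotZ, eigenbasisX, coe_suOfColumn,
      rotXMatrix, rotZMatrix, Matrix.mul_apply, Fin.sum_univ_two]
    ring
  · simp [-Complex.ofReal_cos, -Complex.ofReal_sin, rotX, rotZ, eigenbasisX, coe_suOfColumn,
      rotXMatrix, rotZMatrix, Matrix.mul_apply, Fin.sum_univ_two]
    ring

/-! ### Trigonometric polynomials of fixed parity -/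

/-- `e^{iθ}`. -/
noncomputable def phase (θ : ℝ) : ℂ := Complex.exp (θ * Complex.I)

theorem phase_eq (θ : ℝ) : phase θ = Real.cos θ + Complex.I * Real.sin θ := by
  rw [phase, Complex.exp_mul_I]; push_cast; ring

theorem norm_phase (θ : ℝ) : ‖phase θ‖ = 1 := Complex.norm_exp_ofReal_mul_I θ

theorem phase_ne_zero (θ : ℝ) : phase θ ≠ 0 := Complex.exp_ne_zero _

theorem phase_mul_conj (θ : ℝ) : phase θ * conj (phase θ) = 1 := by
  rw [Complex.mul_conj', norm_phase]; simp

theorem conj_phase_eq (θ : ℝ) : conj (phase θ) = Real.cos θ - Complex.I * Real.sin θ := by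
  rw [phase_eq, map_add, map_mul, Complex.conj_ofReal, Complex.conj_ofReal, Complex.conj_I]; ring

/-- Lets an identity between polynomials be checked on the unit circle only. -/
theorem infinite_range_phase_sq : (Set.range fun θ => phase θ ^ 2).Infinite := by
  have h : Set.InjOn (fun θ => phase θ ^ 2) (Set.Icc 0 1) := by
    intro a ha b hb hab
    simp only [phase, ← Complex.exp_nat_mul] at hab
    obtain ⟨n, hn⟩ := Complex.exp_eq_exp_iff_exists_int.1 hab
    have h1 : a = b + n * Real.pi := by
      have := congrArg Complex.im hn
      simp at this
      linarith
    have hpi := Real.pi_gt_three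
    have hn0 : n = 0 := by
      by_contra h0
      rcases lt_or_gt_of_ne h0 with h0 | h0
      · have : (n : ℝ) ≤ -1 := by exact_mod_cast Int.le_sub_one_of_lt h0
        nlinarith [ha.1, ha.2, hb.1, hb.2]
      · have : (1 : ℝ) ≤ n := by exact_mod_cast h0
        nlinarith [ha.1, ha.2, hb.1, hb.2]
    simpa [hn0] using h1
  exact ((Set.Icc_infinite (by norm_num : (0 : ℝ) < 1)).image h).mono
    (Set.image_subset_range _ _)

/-- `f` is a trigonometric polynomial `∑ c_k e^{ikθ}` over `k ∈ {-d, -d + 2, …, d}`. -/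
def IsTrigPoly (d : ℕ) (f : ℝ → ℂ) : Prop :=
  ∃ P : ℂ[X], P.natDegree ≤ d ∧ ∀ θ, f θ * phase θ ^ d = P.eval (phase θ ^ 2)

namespace IsTrigPoly

variable {d e : ℕ} {f g : ℝ → ℂ}

theorem add (hf : IsTrigPoly d f) (hg : IsTrigPoly d g) : IsTrigPoly d (fun θ => f θ + g θ) := by
  obtain ⟨P, hP, hf⟩ := hf
  obtain ⟨Q, hQ, hg⟩ := hg
  exact ⟨P + Q, (natDegree_add_le _ _).trans (max_le hP hQ), fun θ => by
    rw [add_mul, hf, hg, eval_add]⟩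

theorem mul (hf : IsTrigPoly d f) (hg : IsTrigPoly e g) :
    IsTrigPoly (d + e) (fun θ => f θ * g θ) := by
  obtain ⟨P, hP, hf⟩ := hf
  obtain ⟨Q, hQ, hg⟩ := hg
  exact ⟨P * Q, natDegree_mul_le.trans (add_le_add hP hQ), fun θ => by
    rw [pow_add, mul_mul_mul_comm, hf, hg, eval_mul]⟩

theorem const (c : ℂ) : IsTrigPoly 0 (fun _ => c) := ⟨C c, by simp, by simp⟩

theorem const_mul (c : ℂ) (hf : IsTrigPoly d f) : IsTrigPoly d (fun θ => c * f θ) := by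
  simpa using (const c).mul hf

theorem phase : IsTrigPoly 1 phase := ⟨X, by simp, fun θ => by simp [sq]⟩

theorem conj_phase : IsTrigPoly 1 (fun θ => conj (_root_.phase θ)) :=
  ⟨1, by simp, fun θ => by simp [mul_comm, phase_mul_conj]⟩

theorem cos : IsTrigPoly 1 (fun θ => (Real.cos θ : ℂ)) := by
  convert (phase.add conj_phase).const_mul (1 / 2) using 2 with θ
  rw [conj_phase_eq, phase_eq]; ring

theorem sin : IsTrigPoly 1 (fun θ => (Real.sin θ : ℂ)) := by
  convert (phase.add (conj_phase.const_mul (-1))).const_mul (-Complex.I / 2) using 2 with θ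
  rw [conj_phase_eq, phase_eq]
  linear_combination (Real.sin θ : ℂ) * Complex.I_mul_I

theorem pow (hf : IsTrigPoly d f) (n : ℕ) : IsTrigPoly (n * d) (fun θ => f θ ^ n) := by
  induction n with
  | zero => simpa using const 1
  | succ n ih => simpa only [pow_succ, Nat.succ_mul] using ih.mul hf

theorem one_two : IsTrigPoly 2 (fun _ => 1) := by
  simpa only [phase_mul_conj] using phase.mul conj_phase

/-- Padding: the degree of a trigonometric polynomial may be raised by any even number. -/
theorem one_even (n : ℕ) : IsTrigPoly (n * 2) (fun _ => 1) := by
  simpa using one_two.pow n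

theorem sum {ι : Type*} (s : Finset ι) {F : ι → ℝ → ℂ} (h : ∀ i ∈ s, IsTrigPoly d (F i)) :
    IsTrigPoly d (fun θ => ∑ i ∈ s, F i θ) := by
  classical
  induction s using Finset.induction_on with
  | empty => exact ⟨0, by simp, by simp⟩
  | insert i s hi ih =>
    simp only [Finset.sum_insert hi]
    exact (h i (by simp)).add (ih fun j hj => h j (by simp [hj]))

end IsTrigPoly

/-! ### Generalized quantum signal processing -/

/-- On the unit circle `conj z = z⁻¹`, so conjugating a value of `P` amounts to conjugating its
coefficients and reversing their order. -/
theorem eval_reflect_conj {P : ℂ[X]} {d : ℕ} (hP : P.natDegree ≤ d) (θ : ℝ) :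
    (reflect d (P.map (starRingEnd ℂ))).eval (phase θ ^ 2) =
      (phase θ ^ 2) ^ d * conj (P.eval (phase θ ^ 2)) := by
  have hu : phase θ ^ 2 * conj (phase θ ^ 2) = 1 := by
    rw [map_pow, ← mul_pow, phase_mul_conj, one_pow]
  set z : ℂ := phase θ ^ 2
  let hinv : Invertible (conj z) := ⟨z, hu, (mul_comm _ _).trans hu⟩
  have key : eval z (reflect d (P.map (starRingEnd ℂ))) * (conj z) ^ d =
      eval (conj z) (P.map (starRingEnd ℂ)) := by
    have := eval₂_reflect_mul_pow (RingHom.id ℂ) (conj z) d (P.map (starRingEnd ℂ))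
      (natDegree_map_le.trans hP)
    rw [eval₂_id, eval₂_id] at this
    exact this
  rw [eval_map, eval₂_at_apply] at key
  rw [← key, mul_left_comm, ← mul_pow, hu, one_pow, mul_one]

/-- With `P*` the conjugate reversal, normalization on the circle reads `P P* + Q Q* = X^(d+1)` as
polynomials. The right side has no constant term. -/
theorem coeff_orthogonal {P Q : ℂ[X]} {d : ℕ} (hP : P.natDegree ≤ d + 1)
    (hQ : Q.natDegree ≤ d + 1)
    (h : ∀ θ, ‖P.eval (phase θ ^ 2)‖ ^ 2 + ‖Q.eval (phase θ ^ 2)‖ ^ 2 = 1) :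
    P.coeff 0 * conj (P.coeff (d + 1)) + Q.coeff 0 * conj (Q.coeff (d + 1)) = 0 := by
  have key : P * reflect (d + 1) (P.map (starRingEnd ℂ)) +
      Q * reflect (d + 1) (Q.map (starRingEnd ℂ)) = X ^ (d + 1) := by
    apply eq_of_infinite_eval_eq
    apply infinite_range_phase_sq.mono
    rintro _ ⟨θ, rfl⟩
    have hθ : ((‖P.eval (phase θ ^ 2)‖ ^ 2 + ‖Q.eval (phase θ ^ 2)‖ ^ 2 : ℝ) : ℂ) = 1 := by
      rw [h θ]; simp
    push_cast at hθ
    rw [← Complex.mul_conj', ← Complex.mul_conj'] at hθ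
    simp only [Set.mem_ofPred_eq, eval_add, eval_mul, eval_reflect_conj hP, eval_reflect_conj hQ,
      eval_pow, eval_X]
    linear_combination (phase θ ^ 2) ^ (d + 1) * hθ
  have := congrArg (fun R => R.coeff 0) key
  simpa [mul_coeff_zero, coeff_reflect] using this

/-- The vectors `(a, b)` and `(c, e)` are orthogonal, so a unit vector along `(c, e)` is orthogonal
to `(a, b)`. If `(c, e)` vanishes, any unit vector orthogonal to `(a, b)` serves. -/
theorem exists_unit_vector {a b c e : ℂ} (h : a * conj c + b * conj e = 0) :
    ∃ u v : ℂ, ‖u‖ ^ 2 + ‖v‖ ^ 2 = 1 ∧ conj u * a + conj v * b = 0 ∧ -v * c + u * e = 0 := by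
  have normalize : ∀ x y : ℂ, (x ≠ 0 ∨ y ≠ 0) → ∃ r : ℝ, ‖r * x‖ ^ 2 + ‖r * y‖ ^ 2 = 1 := by
    intro x y hxy
    have hpos : 0 < ‖x‖ ^ 2 + ‖y‖ ^ 2 := by
      rcases hxy with h | h
      · have := norm_pos_iff.2 h; positivity
      · have := norm_pos_iff.2 h; positivity
    refine ⟨(Real.sqrt (‖x‖ ^ 2 + ‖y‖ ^ 2))⁻¹, ?_⟩
    rw [norm_mul, norm_mul, mul_pow, mul_pow, Complex.norm_real, Real.norm_eq_abs, sq_abs,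
      inv_pow, Real.sq_sqrt hpos.le, ← mul_add, inv_mul_cancel₀ hpos.ne']
  by_cases hce : c ≠ 0 ∨ e ≠ 0
  · obtain ⟨r, hr⟩ := normalize c e hce
    refine ⟨r * c, r * e, hr, ?_, by ring⟩
    simp only [map_mul, Complex.conj_ofReal]
    linear_combination r * h
  · push Not at hce
    obtain ⟨rfl, rfl⟩ := hce
    by_cases hab : -conj b ≠ 0 ∨ conj a ≠ 0
    · obtain ⟨r, hr⟩ := normalize (-conj b) (conj a) hab
      refine ⟨r * -conj b, r * conj a, hr, ?_, by ring⟩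
      simp only [map_mul, map_neg, Complex.conj_ofReal, Complex.conj_conj]
      ring
    · push Not at hab
      have ha : a = 0 := by simpa using hab.2
      have hb : b = 0 := by simpa using hab.1
      exact ⟨1, 0, by simp, by simp [ha, hb], by simp⟩

/-- Generalized quantum signal processing: a normalized pair of trigonometric polynomials is the
first column of the unitary of a circuit. -/
theorem exists_circuit_column {d : ℕ} {f g : ℝ → ℂ} (hf : IsTrigPoly d f) (hg : IsTrigPoly d g)
    (h : ∀ θ, ‖f θ‖ ^ 2 + ‖g θ‖ ^ 2 = 1) :
    ∃ c : Circuit 1, c.length ≤ 4 * d + 1 ∧ (c.map (Gate.queryCount 0)).sum ≤ d ∧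
      ∀ θ, (c.eval fun _ => rotX θ).1 0 0 = f θ ∧ (c.eval fun _ => rotX θ).1 1 0 = g θ := by
  induction d generalizing f g with
  | zero =>
    obtain ⟨P, hP, hf⟩ := hf
    obtain ⟨Q, hQ, hg⟩ := hg
    rw [Nat.le_zero, natDegree_eq_zero] at hP hQ
    obtain ⟨p, rfl⟩ := hP
    obtain ⟨q, rfl⟩ := hQ
    simp only [pow_zero, mul_one, eval_C] at hf hg
    have hpq : ‖p‖ ^ 2 + ‖q‖ ^ 2 = 1 := by rw [← hf 0, ← hg 0]; exact h 0
    exact ⟨[.fixed (suOfColumn p q hpq)], by simp, by simp [Gate.queryCount], fun θ => by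
      simp [Circuit.eval, Gate.eval, coe_suOfColumn, hf, hg]⟩
  | succ d ih =>
    obtain ⟨P, hP, hf⟩ := hf
    obtain ⟨Q, hQ, hg⟩ := hg
    have hPQ : ∀ θ, ‖P.eval (phase θ ^ 2)‖ ^ 2 + ‖Q.eval (phase θ ^ 2)‖ ^ 2 = 1 := fun θ => by
      rw [← hf, ← hg, norm_mul, norm_mul, norm_pow, norm_phase, one_pow, mul_one, mul_one, h]
    -- Undoing the fixed gate with first column `(u, v)` kills the lowest coefficient of the first
    -- component and the highest of the second; undoing `e^{iθσ_z}` then recentres the frequencies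
    -- of both, at degree `d`.
    obtain ⟨u, v, huv, h0, h1⟩ := exists_unit_vector (coeff_orthogonal hP hQ hPQ)
    have huv' : u * conj u + v * conj v = 1 := by
      rw [Complex.mul_conj', Complex.mul_conj']; exact_mod_cast huv
    have hf' : IsTrigPoly d (fun θ => (conj u * f θ + conj v * g θ) * conj (phase θ)) := by
      refine ⟨(C (conj u) * P + C (conj v) * Q).divX, ?_, fun θ => ?_⟩
      · rw [natDegree_divX_eq_natDegree_tsub_one, Nat.sub_le_iff_le_add]
        exact (natDegree_add_le _ _).trans
          (max_le ((natDegree_C_mul_le _ _).trans hP) ((natDegree_C_mul_le _ _).trans hQ))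
      · have hd := congrArg (eval (phase θ ^ 2)) (divX_mul_X_add (C (conj u) * P + C (conj v) * Q))
        simp only [eval_add, eval_mul, eval_X, eval_C, coeff_add, coeff_C_mul, h0, add_zero,
          ← hf, ← hg] at hd
        have hne := pow_ne_zero 2 (phase_ne_zero θ)
        apply mul_right_cancel₀ hne
        rw [hd]
        linear_combination (conj u * f θ + conj v * g θ) * phase θ ^ (d + 1) * phase_mul_conj θ
    have hg' : IsTrigPoly d (fun θ => (-v * f θ + u * g θ) * phase θ) := by
      refine ⟨C (-v) * P + C u * Q, ?_, fun θ => ?_⟩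
      · have hle : (C (-v) * P + C u * Q).natDegree ≤ d + 1 := (natDegree_add_le _ _).trans
          (max_le ((natDegree_C_mul_le _ _).trans hP) ((natDegree_C_mul_le _ _).trans hQ))
        rw [natDegree_le_iff_coeff_eq_zero]
        intro N hN
        rcases (Nat.succ_le_of_lt hN).eq_or_lt with rfl | hN
        · simpa only [coeff_add, coeff_C_mul] using h1
        · exact coeff_eq_zero_of_natDegree_lt (hle.trans_lt hN)
      · rw [eval_add, eval_mul, eval_mul, eval_C, eval_C, ← hf, ← hg]
        ring
    obtain ⟨c, hc1, hc2, hc3⟩ := ih hf' hg' fun θ => by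
      have e1 : ((‖f θ‖ ^ 2 + ‖g θ‖ ^ 2 : ℝ) : ℂ) = 1 := by rw [h θ]; simp
      have e2 : ((‖(conj u * f θ + conj v * g θ) * conj (phase θ)‖ ^ 2 +
          ‖(-v * f θ + u * g θ) * phase θ‖ ^ 2 : ℝ) : ℂ) = (1 : ℝ) := by
        rw [norm_mul, norm_mul, Complex.norm_conj, norm_phase, mul_one, mul_one]
        push_cast at e1 ⊢
        rw [← Complex.mul_conj', ← Complex.mul_conj'] at e1 ⊢
        simp only [map_add, map_mul, map_neg, Complex.conj_conj]
        linear_combination (f θ * conj (f θ) + g θ * conj (g θ)) * huv' + e1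
      exact_mod_cast e2
    -- The eigenbasis change on both sides turns the query `e^{iθσ_x}` into `e^{iθσ_z}`: four gates
    -- and one query per degree.
    refine ⟨.fixed (suOfColumn u v huv) :: .fixed eigenbasisX⁻¹ :: .query 0 ::
      .fixed eigenbasisX :: c, by simp; omega, by simp [Gate.queryCount]; omega, fun θ => ?_⟩
    have hev : Circuit.eval (.fixed (suOfColumn u v huv) :: .fixed eigenbasisX⁻¹ :: .query 0 ::
        .fixed eigenbasisX :: c) (fun _ => rotX θ) =
        suOfColumn u v huv * (rotZ θ * c.eval fun _ => rotX θ) := by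
      simp only [Circuit.eval, List.map_cons, List.prod_cons, Gate.eval]
      rw [← mul_assoc (rotX θ), rotX_mul_eigenbasisX, mul_assoc, inv_mul_cancel_left]
    obtain ⟨k0, k1⟩ := hc3 θ
    rw [hev]
    simp only [Submonoid.coe_mul, Matrix.mul_apply, Fin.sum_univ_two, k0, k1, coe_suOfColumn,
      rotZ, rotZMatrix, ← phase_eq, ← conj_phase_eq]
    simp
    have hp := phase_mul_conj θ
    constructor
    · linear_combination (u * conj u * f θ + u * conj v * g θ + v * conj v * f θ
        - u * conj v * g θ) * hp + f θ * huv'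
    · linear_combination (v * conj u * f θ + v * conj v * g θ - v * conj u * f θ
        + u * conj u * g θ) * hp + g θ * huv'

/-! ### Fejér–Riesz factorization in cos² θ -/

theorem norm_sq_ofReal_add_I_mul (a b : ℝ) : ‖(a : ℂ) + Complex.I * b‖ ^ 2 = a ^ 2 + b ^ 2 := by
  rw [mul_comm, Complex.sq_norm, Complex.normSq_add_mul_I]

/-- A Fejér–Riesz theorem: a real polynomial in `cos² θ` which is positive on `(0, ∞)` is the
squared modulus of a trigonometric polynomial. -/
theorem exists_isTrigPoly_norm_sq {d : ℕ} {R : ℝ[X]} (hd : R.natDegree ≤ d)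
    (hR : ∀ x, 0 < x → 0 < R.eval x) :
    ∃ q, IsTrigPoly d q ∧ ∀ θ, ‖q θ‖ ^ 2 = R.eval (Real.cos θ ^ 2) := by
  induction d using Nat.strong_induction_on generalizing R with
  | _ d ih =>
    by_cases h0 : R.natDegree = 0
    · obtain ⟨r, rfl⟩ := natDegree_eq_zero.1 h0
      have hr : 0 < r := by simpa using hR 1 one_pos
      -- A constant is padded to degree `d`, whatever its parity, by a phase of modulus one.
      refine ⟨fun θ => (Real.sqrt r : ℂ) * phase θ ^ d, ?_, fun θ => ?_⟩
      · simpa using (IsTrigPoly.phase.pow d).const_mul (Real.sqrt r : ℂ)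
      · rw [norm_mul, norm_pow, norm_phase, one_pow, mul_one, Complex.norm_real, Real.norm_eq_abs,
          sq_abs, Real.sq_sqrt hr.le, eval_C]
    · have hR0 : R ≠ 0 := by rintro rfl; simp at h0
      obtain ⟨z, hz⟩ := IsAlgClosed.exists_aeval_eq_zero ℂ R
        (natDegree_pos_iff_degree_pos.1 (Nat.pos_of_ne_zero h0)).ne'
      by_cases him : z.im = 0
      · obtain ⟨ρ, rfl⟩ : ∃ ρ : ℝ, z = ρ := ⟨z.re, Complex.ext rfl him⟩
        have hroot : R.eval ρ = 0 := by
          have : ((R.eval ρ : ℝ) : ℂ) = 0 := by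
            rw [← hz]; exact (aeval_algebraMap_apply_eq_algebraMap_eval (A := ℂ) ρ R).symm
          exact_mod_cast this
        have hρ : ρ ≤ 0 := by
          by_contra hlt
          exact (hR ρ (not_le.1 hlt)).ne' hroot
        obtain ⟨S, rfl⟩ := dvd_iff_isRoot.2 hroot
        have hS0 : S ≠ 0 := right_ne_zero_of_mul hR0
        rw [natDegree_mul (X_sub_C_ne_zero ρ) hS0, natDegree_X_sub_C] at hd
        obtain ⟨q, hq, hqS⟩ := ih (d - 1) (by omega) (R := S) (by omega) fun x hx => by
          have := hR x hx
          rw [eval_mul, eval_sub, eval_X, eval_C] at this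
          exact pos_of_mul_pos_right this (by linarith)
        -- For `ρ ≤ 0`, `cos² θ - ρ = (1 - ρ) cos² θ + (-ρ) sin² θ` is the squared modulus of this
        -- factor of degree one.
        refine ⟨fun θ => (((Real.sqrt (1 - ρ) : ℝ) : ℂ) * (Real.cos θ : ℂ) +
          (Complex.I * (Real.sqrt (-ρ) : ℝ)) * (Real.sin θ : ℂ)) * q θ, ?_, fun θ => ?_⟩
        · have := ((IsTrigPoly.cos.const_mul (Real.sqrt (1 - ρ) : ℝ)).add
            (IsTrigPoly.sin.const_mul (Complex.I * (Real.sqrt (-ρ) : ℝ)))).mul hq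
          rwa [show 1 + (d - 1) = d by omega] at this
        · have h1 := norm_sq_ofReal_add_I_mul (Real.sqrt (1 - ρ) * Real.cos θ)
            (Real.sqrt (-ρ) * Real.sin θ)
          rw [mul_pow, mul_pow, Real.sq_sqrt (by linarith), Real.sq_sqrt (by linarith)] at h1
          rw [norm_mul, mul_pow, hqS, eval_mul, eval_sub, eval_X, eval_C]
          push_cast at h1 ⊢
          rw [mul_assoc Complex.I, h1, Real.sin_sq]
          ring
      · obtain ⟨S, rfl⟩ := R.quadratic_dvd_of_aeval_eq_zero_im_ne_zero hz him
        have hS0 : S ≠ 0 := right_ne_zero_of_mul hR0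
        have hdeg : (X ^ 2 - C (2 * z.re) * X + C (‖z‖ ^ 2) : ℝ[X]).natDegree = 2 := by
          compute_degree!
        have hquad : ∀ x : ℝ, (X ^ 2 - C (2 * z.re) * X + C (‖z‖ ^ 2) : ℝ[X]).eval x =
            ‖(x : ℂ) - z‖ ^ 2 := fun x => by
          simp only [eval_add, eval_sub, eval_mul, eval_pow, eval_X, eval_C, Complex.sq_norm,
            Complex.normSq_apply, Complex.sub_re, Complex.sub_im, Complex.ofReal_re,
            Complex.ofReal_im]
          ring
        rw [natDegree_mul (left_ne_zero_of_mul hR0) hS0, hdeg] at hd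
        obtain ⟨q, hq, hqS⟩ := ih (d - 2) (by omega) (R := S) (by omega) fun x hx => by
          have := hR x hx
          rw [eval_mul, hquad] at this
          exact pos_of_mul_pos_right this (by positivity)
        -- A conjugate pair of roots contributes `|cos² θ - z|²`; the constant `z` is viewed as
        -- having degree two.
        refine ⟨fun θ => ((Real.cos θ : ℂ) * (Real.cos θ : ℂ) + -z * 1) * q θ, ?_, fun θ => ?_⟩
        · have := ((IsTrigPoly.cos.mul IsTrigPoly.cos).add
            (IsTrigPoly.one_two.const_mul (-z))).mul hq
          rwa [show 1 + 1 + (d - 2) = d by omega] at this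
        · rw [norm_mul, mul_pow, hqS, eval_mul, hquad]
          congr 3
          push_cast
          ring

theorem isTrigPoly_eval_cos_sq {A : ℝ[X]} {K : ℕ} (hA : A.natDegree ≤ K) :
    IsTrigPoly (2 * K) (fun θ => ((A.eval (Real.cos θ ^ 2) : ℝ) : ℂ)) := by
  have h : ∀ k ∈ Finset.range (K + 1),
      IsTrigPoly (2 * K) (fun θ => (A.coeff k : ℂ) * ((Real.cos θ : ℂ) ^ (2 * k) * 1)) := by
    intro k hk
    have hk' : k ≤ K := Nat.lt_succ_iff.1 (Finset.mem_range.1 hk)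
    have := ((IsTrigPoly.cos.pow (2 * k)).mul (IsTrigPoly.one_even (K - k))).const_mul
      (A.coeff k : ℂ)
    rwa [show 2 * k * 1 + (K - k) * 2 = 2 * K by omega] at this
  convert IsTrigPoly.sum _ h using 2 with θ
  rw [eval_eq_sum_range' (Nat.lt_succ_of_le hA)]
  push_cast
  simp only [pow_mul, mul_one]

/-! ### Truncated series of cos(s arcsin x) and its energy deficit -/

/-- The coefficient of `x ^ (2 * k)` in the power series of `cos (s * arcsin x)`. -/
noncomputable def cosArcsinCoeff (s : ℝ) : ℕ → ℝ
  | 0 => 1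
  | k + 1 => cosArcsinCoeff s k * (4 * k ^ 2 - s ^ 2) / ((2 * k + 2) * (2 * k + 1))

/-- The truncation to degree `K` in `X = x²` of the power series of `cos (s * arcsin x)`. -/
noncomputable def cosArcsinTrunc (s : ℝ) (K : ℕ) : ℝ[X] :=
  ∑ k ∈ Finset.range (K + 1), C (cosArcsinCoeff s k) * X ^ k

theorem coeff_cosArcsinTrunc (s : ℝ) (K n : ℕ) :
    (cosArcsinTrunc s K).coeff n = if n ≤ K then cosArcsinCoeff s n else 0 := by
  simp [cosArcsinTrunc, coeff_C_mul, coeff_X_pow]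

theorem natDegree_cosArcsinTrunc_le (s : ℝ) (K : ℕ) : (cosArcsinTrunc s K).natDegree ≤ K := by
  rw [natDegree_le_iff_coeff_eq_zero]
  intro n hn
  rw [coeff_cosArcsinTrunc, if_neg (not_le.2 hn)]

/-- The recurrence factor is negative only at index `0`, so every later coefficient keeps the sign
of the first one. For `n ≥ 1` it multiplies `n|a_n|` by `(4n² - s²)/(2n(2n + 1)) < 1`. -/
theorem cosArcsinCoeff_bounds {s : ℝ} (h0 : 0 < s) (h1 : s ≤ 1) (k : ℕ) :
    cosArcsinCoeff s (k + 1) ≤ 0 ∧ -cosArcsinCoeff s (k + 1) * (k + 1) ≤ s ^ 2 := by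
  have hs : 0 < s ^ 2 := by positivity
  have hs1 : s ^ 2 ≤ 1 := by nlinarith
  induction k with
  | zero => simp [cosArcsinCoeff]; constructor <;> linarith
  | succ k ih =>
    obtain ⟨ih1, ih2⟩ := ih
    rw [cosArcsinCoeff]
    set a := cosArcsinCoeff s (k + 1)
    push_cast
    have hk : (0 : ℝ) ≤ k := k.cast_nonneg
    have hf : 0 ≤ 4 * ((k : ℝ) + 1) ^ 2 - s ^ 2 := by nlinarith
    constructor
    · apply div_nonpos_of_nonpos_of_nonneg (mul_nonpos_of_nonpos_of_nonneg ih1 hf)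
      positivity
    · rw [← neg_div, div_mul_eq_mul_div, div_le_iff₀ (by positivity)]
      have e1 : -(a * (4 * ((k : ℝ) + 1) ^ 2 - s ^ 2)) ≤ 4 * (k + 1) * s ^ 2 := by
        nlinarith [mul_nonneg (neg_nonneg.2 ih1) hs.le]
      have e2 := mul_le_mul_of_nonneg_right e1 (by positivity : (0 : ℝ) ≤ k + 1 + 1)
      nlinarith [mul_nonneg hk hs.le, mul_nonneg (mul_nonneg hk hk) hs.le]

/-- This is `(1 - x²)y'' - xy' + s²y = 0`, the equation of `cos(s·arcsin x)`, rewritten in `X = x²`.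
The coefficient recurrence cancels everything except the top term of the truncation. -/
theorem cosArcsinTrunc_ode (s : ℝ) (K : ℕ) :
    4 * X * (1 - X) * derivative (derivative (cosArcsinTrunc s K)) +
      (2 - 4 * X) * derivative (cosArcsinTrunc s K) + C (s ^ 2) * cosArcsinTrunc s K =
    C (cosArcsinCoeff s K * (s ^ 2 - 4 * K ^ 2)) * X ^ K := by
  induction K with
  | zero => simp [cosArcsinTrunc, cosArcsinCoeff]
  | succ K ih =>
    have hsucc : cosArcsinTrunc s (K + 1) =
        cosArcsinTrunc s K + C (cosArcsinCoeff s (K + 1)) * X ^ (K + 1) := by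
      rw [cosArcsinTrunc, Finset.sum_range_succ, ← cosArcsinTrunc]
    have hrec : C (cosArcsinCoeff s (K + 1)) * ((2 * K + 2) * (2 * K + 1)) =
        C (cosArcsinCoeff s K) * (4 * K ^ 2 - C s ^ 2) := by
      have : cosArcsinCoeff s (K + 1) * ((2 * K + 2) * (2 * K + 1)) =
          cosArcsinCoeff s K * (4 * K ^ 2 - s ^ 2) := by
        rw [cosArcsinCoeff, div_mul_cancel₀ _ (by positivity)]
      have := congrArg C this
      simp only [map_mul, map_add, map_sub, map_pow, map_ofNat, map_natCast, map_one] at this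
      exact this
    have hX : X * derivative (derivative (X ^ (K + 1) : ℝ[X])) = ((K : ℝ[X]) + 1) * (K : ℝ[X]) * X ^ K := by
      rcases K with _ | K
      · simp
      · simp; ring
    have hX' : derivative (X ^ (K + 1) : ℝ[X]) = ((K : ℝ[X]) + 1) * X ^ K := by
      simp
    rw [hsucc]
    simp only [derivative_add, derivative_C_mul, C_mul, C_sub, C_pow] at ih ⊢
    push_cast
    simp only [map_natCast, map_add, map_one, map_ofNat] at ih ⊢
    linear_combination ih + C (cosArcsinCoeff s (K + 1)) * 4 * (1 - X) * hX +
      C (cosArcsinCoeff s (K + 1)) * (2 - 4 * X) * hX' + X ^ K * hrec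

/-- The deficit `1 - A² - (dA/dθ)² / s²`, as a polynomial in `X = cos² θ`, of the truncation
`A` of the power series of `cos (s * arcsin x)`. -/
noncomputable def cosArcsinDeficit (s : ℝ) (K : ℕ) : ℝ[X] :=
  1 - cosArcsinTrunc s K ^ 2 -
    C (4 / s ^ 2) * (X * (1 - X) * derivative (cosArcsinTrunc s K) ^ 2)

theorem natDegree_cosArcsinDeficit_le (s : ℝ) {K : ℕ} (hK : 1 ≤ K) :
    (cosArcsinDeficit s K).natDegree ≤ 2 * K := by
  have h1 := natDegree_cosArcsinTrunc_le s K
  have h2 : (derivative (cosArcsinTrunc s K)).natDegree ≤ K - 1 :=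
    (natDegree_derivative_le _).trans (Nat.sub_le_sub_right h1 1)
  have h3 : (X * (1 - X) * derivative (cosArcsinTrunc s K) ^ 2 : ℝ[X]).natDegree ≤ 2 * K := by
    have e1 : (X * (1 - X) : ℝ[X]).natDegree ≤ 2 := by compute_degree
    have e2 := natDegree_pow_le_of_le 2 h2
    exact (natDegree_mul_le_of_le e1 e2).trans (by omega)
  have h4 := natDegree_pow_le_of_le 2 h1
  rw [cosArcsinDeficit]
  refine (natDegree_sub_le_of_le (natDegree_sub_le_of_le (m := 0) (by simp) h4)
    ((natDegree_C_mul_le _ _).trans h3)).trans ?_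
  simp

/-- Energy balance: multiplying the differential equation by the derivative of the truncation leaves
only the work done by the residual. -/
theorem derivative_cosArcsinDeficit {s : ℝ} (hs : 0 < s) (K : ℕ) :
    derivative (cosArcsinDeficit s K) =
      C (2 / s ^ 2 * (cosArcsinCoeff s K * (4 * K ^ 2 - s ^ 2))) *
        (derivative (cosArcsinTrunc s K) * X ^ K) := by
  have h := cosArcsinTrunc_ode s K
  have hc : C (2 / s ^ 2) * C (s ^ 2) = (2 : ℝ[X]) := by
    rw [← C_mul, div_mul_cancel₀ _ (by positivity)]; rfl
  have h4 : C (4 / s ^ 2) = 2 * C (2 / s ^ 2) := by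
    rw [show 4 / s ^ 2 = 2 * (2 / s ^ 2) by ring, C_mul]; rfl
  rw [show cosArcsinCoeff s K * (s ^ 2 - 4 * K ^ 2) =
    -(cosArcsinCoeff s K * (4 * K ^ 2 - s ^ 2)) by ring, C_neg] at h
  rw [C_mul, cosArcsinDeficit, h4]
  simp only [derivative_sub, derivative_one, derivative_mul, derivative_pow, derivative_X,
    derivative_C, derivative_ofNat, Nat.cast_ofNat, Nat.add_one_sub_one, pow_one, map_ofNat]
  set A := cosArcsinTrunc s K
  linear_combination (-C (2 / s ^ 2) * derivative A) * h + A * derivative A * hc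

/-- The deficit vanishes at `0`, and its derivative is a nonpositive multiple of `X^K A'`, where
`A'` has nonpositive coefficients. -/
theorem coeff_cosArcsinDeficit_nonneg {s : ℝ} (h0 : 0 < s) (h1 : s ≤ 1) {K : ℕ} (hK : 1 ≤ K)
    (n : ℕ) : 0 ≤ (cosArcsinDeficit s K).coeff n := by
  have hcoef : ∀ k : ℕ, 1 ≤ k → cosArcsinCoeff s k ≤ 0 := fun k hk => by
    obtain ⟨j, rfl⟩ := Nat.exists_eq_add_of_le' hk
    exact (cosArcsinCoeff_bounds h0 h1 j).1
  rcases n with _ | n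
  · simp [cosArcsinDeficit, coeff_cosArcsinTrunc, cosArcsinCoeff, mul_coeff_zero, sq]
  · have hd := congrArg (fun P => P.coeff n) (derivative_cosArcsinDeficit h0 K)
    simp only [coeff_derivative, coeff_C_mul, coeff_mul_X_pow'] at hd
    have hK' : (1 : ℝ) ≤ K := by exact_mod_cast hK
    have hc : 2 / s ^ 2 * (cosArcsinCoeff s K * (4 * K ^ 2 - s ^ 2)) ≤ 0 :=
      mul_nonpos_of_nonneg_of_nonpos (by positivity)
        (mul_nonpos_of_nonpos_of_nonneg (hcoef K hK) (by nlinarith))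
    have hr : 0 ≤ (cosArcsinDeficit s K).coeff (n + 1) * ((n : ℝ) + 1) := by
      rw [hd]
      apply mul_nonneg_of_nonpos_of_nonpos hc
      split_ifs
      · rw [coeff_cosArcsinTrunc]
        split_ifs
        · exact mul_nonpos_of_nonpos_of_nonneg (hcoef _ (by omega)) (by positivity)
        · simp
      · exact le_rfl
    exact nonneg_of_mul_nonneg_left hr (by positivity)

/-- A nonzero polynomial with nonnegative coefficients is positive on `(0, ∞)`, so Fejér–Riesz
applies to the deficit. -/
theorem exists_isTrigPoly_deficit {s : ℝ} (h0 : 0 < s) (h1 : s ≤ 1) {K : ℕ} (hK : 1 ≤ K) :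
    ∃ q, IsTrigPoly (2 * K) q ∧
      ∀ θ, ‖q θ‖ ^ 2 = (cosArcsinDeficit s K).eval (Real.cos θ ^ 2) := by
  by_cases hE : cosArcsinDeficit s K = 0
  · exact ⟨fun _ => 0, by simpa using (IsTrigPoly.cos.pow (2 * K)).const_mul 0, by simp [hE]⟩
  · refine exists_isTrigPoly_norm_sq (natDegree_cosArcsinDeficit_le s hK) fun x hx => ?_
    obtain ⟨n, hn⟩ : ∃ n, (cosArcsinDeficit s K).coeff n ≠ 0 := by
      by_contra! h
      exact hE (ext fun n => by simpa using h n)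
    have hc := coeff_cosArcsinDeficit_nonneg h0 h1 hK
    rw [eval_eq_sum, sum_def]
    exact Finset.sum_pos' (fun i _ => mul_nonneg (hc i) (by positivity))
      ⟨n, mem_support_iff.2 hn, mul_pos ((hc n).lt_of_ne' hn) (by positivity)⟩

/-! ### Approximation of e^{isθ} away from 0 and π -/

/-- `A + (i / s) dA/dy` in terms of `θ = π / 2 - y`, for the truncation `A` of the power series of
`cos (s * y)` in `sin y`. -/
noncomputable def powerTrunc (s : ℝ) (K : ℕ) (θ : ℝ) : ℂ :=
  ((cosArcsinTrunc s K).eval (Real.cos θ ^ 2) : ℝ) + Complex.I *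
    ((2 / s * (Real.cos θ * Real.sin θ *
      (derivative (cosArcsinTrunc s K)).eval (Real.cos θ ^ 2)) : ℝ) : ℂ)

theorem isTrigPoly_powerTrunc (s : ℝ) {K : ℕ} (hK : 1 ≤ K) :
    IsTrigPoly (2 * K) (powerTrunc s K) := by
  have h1 := natDegree_cosArcsinTrunc_le s K
  have h2 : (derivative (cosArcsinTrunc s K)).natDegree ≤ K - 1 :=
    (natDegree_derivative_le _).trans (Nat.sub_le_sub_right h1 1)
  have h3 := ((IsTrigPoly.cos.mul IsTrigPoly.sin).mul (isTrigPoly_eval_cos_sq h2)).const_mul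
    (Complex.I * (2 / s : ℝ))
  rw [show 1 + 1 + 2 * (K - 1) = 2 * K by omega] at h3
  convert (isTrigPoly_eval_cos_sq h1).add h3 using 2 with θ
  rw [powerTrunc]
  push_cast
  ring

theorem norm_sq_powerTrunc {s : ℝ} (hs : 0 < s) (K : ℕ) (θ : ℝ) :
    ‖powerTrunc s K θ‖ ^ 2 = 1 - (cosArcsinDeficit s K).eval (Real.cos θ ^ 2) := by
  rw [powerTrunc, norm_sq_ofReal_add_I_mul, cosArcsinDeficit]
  simp only [eval_sub, eval_one, eval_pow, eval_mul, eval_C, eval_X]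
  have := Real.sin_sq_add_cos_sq θ
  rw [mul_pow, mul_pow, mul_pow, Real.sin_sq]
  field_simp
  ring

/-- The second-order equation as a first-order one, `f' = isf` plus a residual proportional to
`cos^{2K} θ`. -/
theorem hasDerivAt_powerTrunc {s : ℝ} (hs : 0 < s) (K : ℕ) (θ : ℝ) :
    HasDerivAt (powerTrunc s K) (Complex.I * s * powerTrunc s K θ - Complex.I *
      ((cosArcsinCoeff s K * (s ^ 2 - 4 * K ^ 2) / s * (Real.cos θ ^ 2) ^ K : ℝ) : ℂ)) θ := by
  have hX : HasDerivAt (fun θ => Real.cos θ ^ 2) (-(2 * (Real.cos θ * Real.sin θ))) θ := by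
    refine ((Real.hasDerivAt_cos θ).pow 2).congr_deriv ?_
    push_cast; ring
  have hA := ((cosArcsinTrunc s K).hasDerivAt (Real.cos θ ^ 2)).comp θ hX
  have hA' := ((derivative (cosArcsinTrunc s K)).hasDerivAt (Real.cos θ ^ 2)).comp θ hX
  have hB := ((((Real.hasDerivAt_cos θ).mul (Real.hasDerivAt_sin θ)).mul hA').const_mul (2 / s))
  have hode := congrArg (eval (Real.cos θ ^ 2)) (cosArcsinTrunc_ode s K)
  simp only [eval_add, eval_mul, eval_sub, eval_X, eval_one, eval_C, eval_pow, eval_ofNat] at hode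
  refine HasDerivAt.congr_deriv (f := powerTrunc s K)
    (hA.ofReal_comp.add (hB.ofReal_comp.const_mul Complex.I)) ?_
  rw [powerTrunc]
  simp only [Function.comp, Pi.mul_apply]
  set a := eval (Real.cos θ ^ 2) (cosArcsinTrunc s K)
  set b := eval (Real.cos θ ^ 2) (derivative (cosArcsinTrunc s K))
  set c := eval (Real.cos θ ^ 2) (derivative (derivative (cosArcsinTrunc s K)))
  have hsin := Real.sin_sq θ
  have hsne : s ≠ 0 := hs.ne'
  have e : cosArcsinCoeff s K * (s ^ 2 - 4 * K ^ 2) / s * (Real.cos θ ^ 2) ^ K =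
      s * a - 2 / s * ((-Real.sin θ * Real.sin θ + Real.cos θ * Real.cos θ) * b +
        Real.cos θ * Real.sin θ * (c * -(2 * (Real.cos θ * Real.sin θ)))) := by
    field_simp
    rw [← hode]
    linear_combination (-2 * b - 4 * Real.cos θ ^ 2 * c) * hsin
  rw [e]
  have hse : (s : ℂ) ≠ 0 := by exact_mod_cast hsne
  push_cast
  field_simp
  linear_combination (-2 * b * Complex.cos θ * Complex.sin θ * s : ℂ) * Complex.I_sq

theorem powerTrunc_pi_div_two (s : ℝ) (K : ℕ) : powerTrunc s K (Real.pi / 2) = 1 := by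
  simp [powerTrunc, ← coeff_zero_eq_eval_zero, coeff_cosArcsinTrunc, cosArcsinCoeff]

theorem hasDerivAt_phase_affine (s a τ : ℝ) :
    HasDerivAt (fun τ => phase (-(s * (τ - a)))) (-(Complex.I * s) * phase (-(s * (τ - a)))) τ := by
  have h : HasDerivAt (fun τ : ℝ => -(s * (τ - a))) (-s) τ := by
    refine (((hasDerivAt_id τ).sub_const a).const_mul s).neg.congr_deriv ?_
    ring
  have := (h.ofReal_comp.mul_const Complex.I).cexp
  refine this.congr_deriv ?_
  rw [phase]
  push_cast
  ring

/-- Multiplied by the integrating factor `e^{-is(θ - π/2)}`, the function has only the residual as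
derivative. It equals `1` at `π/2`, so the mean value inequality on the interval where `|cos| ≤ r`
gives the bound. -/
theorem norm_powerTrunc_sub_le {s : ℝ} (h0 : 0 < s) (h1 : s ≤ 1) {K : ℕ} (hK : 1 ≤ K) {r θ : ℝ}
    (hr0 : 0 ≤ r) (hθ : θ ∈ Set.Icc 0 Real.pi) (hr : |Real.cos θ| ≤ r) :
    ‖powerTrunc s K θ - phase (s * (θ - Real.pi / 2))‖ ≤ 8 * K * r ^ (2 * K) := by
  wlog hr1 : r ≤ 1 generalizing r
  · have h := this zero_le_one (Real.abs_cos_le_one θ) le_rfl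
    exact h.trans (mul_le_mul_of_nonneg_left
      (pow_le_pow_left₀ zero_le_one (le_of_not_ge hr1) _) (by positivity))
  set g : ℝ → ℂ := fun τ => powerTrunc s K τ * phase (-(s * (τ - Real.pi / 2))) with hg
  set κ : ℝ := cosArcsinCoeff s K * (s ^ 2 - 4 * K ^ 2) / s with hκ
  -- The coefficient bound gives `K|a_K| ≤ s² ≤ s`, which absorbs the division by `s`: the estimate
  -- is uniform in `s`.
  have hκ_le : |κ| ≤ 4 * K := by
    obtain ⟨j, rfl⟩ := Nat.exists_eq_add_of_le' hK
    obtain ⟨b1, b2⟩ := cosArcsinCoeff_bounds h0 h1 j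
    have hj : (0 : ℝ) ≤ j := j.cast_nonneg
    have hs2 : s ^ 2 ≤ s := by nlinarith
    push_cast at hκ ⊢
    rw [abs_le, hκ, le_div_iff₀ h0, div_le_iff₀ h0]
    have hb := mul_le_mul_of_nonneg_right b2 (by positivity : (0 : ℝ) ≤ 4 * (j + 1))
    have hf : s ^ 2 - 4 * ((j : ℝ) + 1) ^ 2 ≤ 0 := by nlinarith
    constructor
    · have := mul_nonneg_of_nonpos_of_nonpos b1 hf
      nlinarith
    · nlinarith [mul_nonneg (neg_nonneg.2 b1) (sq_nonneg s)]
  have hder : ∀ τ, HasDerivAt g (-(Complex.I * ((κ * (Real.cos τ ^ 2) ^ K : ℝ) : ℂ)) *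
      phase (-(s * (τ - Real.pi / 2)))) τ := fun τ => by
    refine ((hasDerivAt_powerTrunc h0 K τ).mul
      (hasDerivAt_phase_affine s (Real.pi / 2) τ)).congr_deriv ?_
    ring
  have hα : Real.arccos r ≤ Real.pi / 2 := Real.arccos_le_pi_div_two.2 hr0
  have hα0 := Real.arccos_nonneg r
  obtain ⟨hlo, hhi⟩ := abs_le.1 hr
  have hcosα : Real.cos (Real.arccos r) = r := Real.cos_arccos (by linarith) hr1
  have hmem : θ ∈ Set.Icc (Real.arccos r) (Real.pi - Real.arccos r) := by
    constructor
    · rw [← Real.arccos_cos hθ.1 hθ.2]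
      exact Real.antitone_arccos hhi
    · rw [← Real.arccos_neg, ← Real.arccos_cos hθ.1 hθ.2]
      exact Real.antitone_arccos hlo
  have hbound : ∀ τ ∈ Set.Icc (Real.arccos r) (Real.pi - Real.arccos r),
      ‖-(Complex.I * ((κ * (Real.cos τ ^ 2) ^ K : ℝ) : ℂ)) * phase (-(s * (τ - Real.pi / 2)))‖ ≤
        4 * K * r ^ (2 * K) := by
    rintro τ ⟨h2, h3⟩
    have c1 : Real.cos τ ≤ r := by
      rw [← hcosα]
      exact Real.cos_le_cos_of_nonneg_of_le_pi hα0 (by linarith) h2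
    have c2 : -r ≤ Real.cos τ := by
      rw [← hcosα, ← Real.cos_pi_sub]
      exact Real.cos_le_cos_of_nonneg_of_le_pi (by linarith) (by linarith) h3
    rw [norm_mul, norm_phase, mul_one, norm_neg, norm_mul, Complex.norm_I, one_mul,
      Complex.norm_real, Real.norm_eq_abs, abs_mul, ← pow_mul, abs_pow]
    exact mul_le_mul hκ_le (pow_le_pow_left₀ (abs_nonneg _) (abs_le.2 ⟨c2, c1⟩) _)
      (by positivity) (by positivity)
  have hmv := (convex_Icc _ _).norm_image_sub_le_of_norm_hasDerivWithin_le
    (fun τ _ => (hder τ).hasDerivWithinAt) hbound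
    (Set.mem_Icc.2 ⟨hα, by linarith⟩) hmem
  have hgp : g (Real.pi / 2) = 1 := by
    simp only [hg, powerTrunc_pi_div_two, sub_self, mul_zero, neg_zero]
    simp [phase]
  have hgθ : powerTrunc s K θ - phase (s * (θ - Real.pi / 2)) =
      (g θ - g (Real.pi / 2)) * phase (s * (θ - Real.pi / 2)) := by
    rw [hgp, sub_mul, one_mul, hg, mul_assoc]
    simp only [phase]
    rw [← Complex.exp_add, ← add_mul]
    simp
  rw [hgθ, norm_mul, norm_phase, mul_one]
  have habs : ‖θ - Real.pi / 2‖ ≤ 2 := by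
    rw [Real.norm_eq_abs, abs_le]
    have := Real.pi_lt_four
    constructor <;> linarith [hθ.1, hθ.2]
  calc ‖g θ - g (Real.pi / 2)‖ ≤ 4 * K * r ^ (2 * K) * ‖θ - Real.pi / 2‖ := hmv
    _ ≤ 4 * K * r ^ (2 * K) * 2 := by gcongr
    _ = 8 * K * r ^ (2 * K) := by ring

/-- The power `e^{isθ}` is approximated, away from `θ ∈ {0, π}`, by a trigonometric polynomial
which has a complement. -/
theorem exists_isTrigPoly_approx_phase {s : ℝ} (h0 : 0 < s) (h1 : s ≤ 1) {K : ℕ} (hK : 1 ≤ K) :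
    ∃ f g : ℝ → ℂ, IsTrigPoly (2 * K) f ∧ IsTrigPoly (2 * K) g ∧
      (∀ θ, ‖f θ‖ ^ 2 + ‖g θ‖ ^ 2 = 1) ∧
      ∀ r θ : ℝ, 0 ≤ r → θ ∈ Set.Icc 0 Real.pi → |Real.cos θ| ≤ r →
        ‖f θ - phase (s * θ)‖ ≤ 8 * K * r ^ (2 * K) := by
  obtain ⟨q, hq, hq'⟩ := exists_isTrigPoly_deficit h0 h1 hK
  -- The series is centred at `θ = π/2`; the constant phase moves the value there to `e^{isπ/2}`.
  refine ⟨fun θ => phase (s * (Real.pi / 2)) * powerTrunc s K θ, q,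
    (isTrigPoly_powerTrunc s hK).const_mul _, hq, fun θ => ?_, fun r θ hr0 hθ hr => ?_⟩
  · rw [norm_mul, norm_phase, one_mul, norm_sq_powerTrunc h0, hq']
    ring
  · have : phase (s * θ) = phase (s * (Real.pi / 2)) * phase (s * (θ - Real.pi / 2)) := by
      simp only [phase]
      rw [← Complex.exp_add]
      push_cast
      ring_nf
    rw [this, ← mul_sub, norm_mul, norm_phase, one_mul]
    exact norm_powerTrunc_sub_le h0 h1 hK hr0 hθ hr

/-! ### Mirror symmetry and gadgets -/

/-- The anti-automorphism `V ↦ σ_x Vᵀ σ_x` of `SU(2)`. -/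
noncomputable def SU2.mirror (V : SU2) : SU2 :=
  suOfColumn (conj (V.1 0 0)) (V.1 1 0) (by rw [Complex.norm_conj]; exact V.normSq_column)

theorem SU2.coe_mirror (V : SU2) :
    (V.mirror : Matrix (Fin 2) (Fin 2) ℂ) = !![V.1 1 1, V.1 0 1; V.1 1 0, V.1 0 0] := by
  rw [SU2.mirror, coe_suOfColumn, V.apply_one_one.1, V.apply_one_one.2, Complex.conj_conj]

theorem SU2.mirror_mul (V W : SU2) : (V * W).mirror = W.mirror * V.mirror := by
  apply SU2.ext_of_column <;>
  · simp only [Submonoid.coe_mul, SU2.coe_mirror, Matrix.mul_apply, Fin.sum_univ_two]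
    simp
    ring

theorem SU2.mirror_one : SU2.mirror 1 = 1 := by
  apply SU2.ext_of_column <;> simp [SU2.coe_mirror]

theorem mirror_rotX (θ : ℝ) : (rotX θ).mirror = rotX θ := by
  apply SU2.ext_of_column <;>
    simp [-Complex.ofReal_cos, -Complex.ofReal_sin, SU2.coe_mirror, rotX, rotXMatrix]

theorem rotX_mul_rotX (a b : ℝ) : rotX a * rotX b = rotX (a + b) := by
  apply SU2.ext_of_column <;>
  · simp [-Complex.ofReal_cos, -Complex.ofReal_sin, rotX, rotXMatrix, Real.cos_add,
      Real.sin_add]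
    grind [Complex.I_mul_I]

/-- The gate whose unitary is the mirror image of that of `g`, on mirror symmetric oracles. -/
noncomputable def Gate.mirror {a : ℕ} : Gate a → Gate a
  | .query k => .query k
  | .fixed V => .fixed V.mirror

/-- The circuit whose unitary is the mirror image of that of `c`, on mirror symmetric oracles. -/
noncomputable def Circuit.mirror {a : ℕ} (c : Circuit a) : Circuit a :=
  (c.map Gate.mirror).reverse

theorem Circuit.eval_append {a : ℕ} (c c' : Circuit a) (U : Fin a → SU2) :
    Circuit.eval (c ++ c') U = c.eval U * c'.eval U := by
  simp [Circuit.eval]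

theorem Circuit.eval_mirror {a : ℕ} (c : Circuit a) {U : Fin a → SU2}
    (hU : ∀ k, (U k).mirror = U k) : c.mirror.eval U = (c.eval U).mirror := by
  induction c with
  | nil => simp [Circuit.eval, Circuit.mirror, SU2.mirror_one]
  | cons g c ih =>
    have hg : g.mirror.eval U = (g.eval U).mirror := by
      cases g <;> simp [Gate.mirror, Gate.eval, hU]
    have h1 : Circuit.mirror (g :: c) = Circuit.mirror c ++ [g.mirror] := by simp [Circuit.mirror]
    have h2 : Circuit.eval (g :: c) U = g.eval U * Circuit.eval c U := by simp [Circuit.eval]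
    rw [h1, h2, Circuit.eval_append, ih, SU2.mirror_mul, ← hg]
    simp [Circuit.eval]

theorem Circuit.sum_queryCount_mirror {a : ℕ} (c : Circuit a) (j : Fin a) :
    (c.mirror.map (Gate.queryCount j)).sum = (c.map (Gate.queryCount j)).sum := by
  rw [Circuit.mirror, List.map_reverse, List.sum_reverse, List.map_map]
  congr 2
  funext g
  cases g <;> rfl

/-- A real upper left entry is `cos θ` for some `θ ∈ [0, π]`; the lower left entry then has modulus
`sin θ`, and the twist `φ` absorbs its argument. -/
theorem twistedEmbeddable_of_im_eq_zero {V : SU2} (h : (V.1 0 0).im = 0) :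
    TwistedEmbeddable V := by
  obtain ⟨x, hx⟩ : ∃ x : ℝ, V.1 0 0 = x := ⟨(V.1 0 0).re, Complex.ext rfl h⟩
  have hn := V.normSq_column
  rw [hx, Complex.norm_real, Real.norm_eq_abs, sq_abs] at hn
  have hx1 : -1 ≤ x ∧ x ≤ 1 := 
    abs_le.1 (abs_le_one_iff_mul_self_le_one.2 (by nlinarith [sq_nonneg ‖V.1 1 0‖]))
  set y : ℂ := V.1 1 0 with hy
  have hsin : Real.sin (Real.arccos x) = ‖y‖ := by
    rw [Real.sin_arccos, show 1 - x ^ 2 = ‖y‖ ^ 2 by linarith, Real.sqrt_sq (norm_nonneg _)]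
  -- the lower left entry of the twisted rotation is `i e^{-iφ} sin θ`
  set φ : ℝ := -Complex.arg (-Complex.I * y) with hφ
  have harg := Complex.arg_mem_Ioc (-Complex.I * y)
  refine ⟨Real.arccos x, ⟨Real.arccos_nonneg x, Real.arccos_le_pi x⟩, φ,
    ⟨by linarith [harg.2], by linarith [harg.1]⟩, ?_⟩
  have hz := Complex.norm_mul_exp_arg_mul_I (-Complex.I * y)
  rw [norm_mul, norm_neg, Complex.norm_I, one_mul] at hz
  have hexp : Complex.exp (Complex.arg (-Complex.I * y) * Complex.I) =
      conj (phase (φ / 2)) * conj (phase (φ / 2)) := by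
    rw [phase, ← Complex.exp_conj, ← Complex.exp_add]
    congr 1
    rw [map_mul, Complex.conj_ofReal, Complex.conj_I, hφ]
    push_cast
    ring
  rw [hexp] at hz
  have hneg : rotZMatrix (-(φ / 2)) = !![conj (phase (φ / 2)), 0; 0, phase (φ / 2)] := by
    rw [conj_phase_eq, phase_eq, rotZMatrix, Real.cos_neg, Real.sin_neg]
    simp only [Complex.ofReal_neg, mul_neg, sub_neg_eq_add, ← sub_eq_add_neg]
  have hpos : rotZMatrix (φ / 2) = !![phase (φ / 2), 0; 0, conj (phase (φ / 2))] := by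
    rw [conj_phase_eq, phase_eq, rotZMatrix]
  have hp := phase_mul_conj (φ / 2)
  apply SU2.ext_of_column
  · simp only [Submonoid.coe_mul, rotZ, rotX, hneg, hpos, rotXMatrix, Matrix.mul_apply,
      Fin.sum_univ_two, hsin, Real.cos_arccos hx1.1 hx1.2, hx]
    simp
    linear_combination (-x : ℂ) * hp
  · simp only [Submonoid.coe_mul, rotZ, rotX, hneg, hpos, rotXMatrix, Matrix.mul_apply,
      Fin.sum_univ_two, hsin, Real.cos_arccos hx1.1 hx1.2, ← hy]
    simp
    linear_combination (-Complex.I) * hz + y * Complex.I_mul_I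

/-- The entry is `V₀₀V₁₁ + V₀₁V₁₀ = |V₀₀|² - |V₁₀|²`. -/
theorem im_mul_mirror (V : SU2) : ((V * V.mirror).1 0 0).im = 0 := by
  simp only [Submonoid.coe_mul, SU2.coe_mirror, Matrix.mul_apply, Fin.sum_univ_two]
  simp [V.apply_one_one.1, V.apply_one_one.2]
  ring

/-- A circuit followed by its mirror image is a gadget. -/
noncomputable def mirrorGadget (c : Circuit 1) : SingleQubitGadget 1 1 where
  circuit _ := c ++ c.mirror
  isGadget U hU k := by
    apply twistedEmbeddable_of_im_eq_zero
    change (((c ++ c.mirror : Circuit 1).eval U).1 0 0).im = 0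
    rw [Circuit.eval_append, Circuit.eval_mirror c fun j => ?_]
    · exact im_mul_mirror _
    · obtain ⟨θ, -, hθ⟩ := hU j
      rw [hθ, mirror_rotX]

theorem mirrorGadget_response (c : Circuit 1) (x : ℝ) :
    (mirrorGadget c).response x = (c.eval fun _ => rotX (Real.arccos x)) *
      (c.eval fun _ => rotX (Real.arccos x)).mirror := by
  rw [SingleQubitGadget.response, SingleQubitGadget.output, mirrorGadget, Circuit.eval_append,
    Circuit.eval_mirror c fun _ => mirror_rotX _]

theorem mirrorGadget_depth (c : Circuit 1) : (mirrorGadget c).depth = 2 * c.length := by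
  simp [SingleQubitGadget.depth, mirrorGadget, Circuit.mirror, two_mul]

theorem mirrorGadget_cost (c : Circuit 1) :
    (mirrorGadget c).cost 0 0 = 2 * (c.map (Gate.queryCount 0)).sum := by
  simp only [SingleQubitGadget.cost, mirrorGadget, List.map_append, List.sum_append,
    Circuit.sum_queryCount_mirror, two_mul]

/-! ### Operator norm estimates -/

theorem opNorm_mul_le (A B : Matrix (Fin 2) (Fin 2) ℂ) : opNorm (A * B) ≤ opNorm A * opNorm B := by
  rw [opNorm, map_mul]; exact norm_mul_le _ _

theorem opNorm_add_le (A B : Matrix (Fin 2) (Fin 2) ℂ) : opNorm (A + B) ≤ opNorm A + opNorm B := by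
  rw [opNorm, map_add]; exact norm_add_le _ _

theorem opNorm_nonneg (A : Matrix (Fin 2) (Fin 2) ℂ) : 0 ≤ opNorm A := norm_nonneg _

theorem opNorm_coe_le_one (V : SU2) : opNorm V.1 ≤ 1 := by
  have h := Matrix.mem_unitaryGroup_iff'.1 (Matrix.mem_specialUnitaryGroup_iff.1 V.2).1
  have h2 : opNorm V.1 * opNorm V.1 = ‖(1 : EuclideanSpace ℂ (Fin 2) →L[ℂ] EuclideanSpace ℂ (Fin 2))‖ := by
    rw [opNorm, ← CStarRing.norm_star_mul_self, ← map_star, ← map_mul, h, map_one]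
  rw [norm_one] at h2
  nlinarith [opNorm_nonneg V.1]

theorem opNorm_conj_le (V W : SU2) (A : Matrix (Fin 2) (Fin 2) ℂ) :
    opNorm (V.1 * A * W.1) ≤ opNorm A := by
  have h1 := opNorm_mul_le (V.1 * A) W.1
  have h2 := opNorm_mul_le V.1 A
  have := opNorm_coe_le_one V
  have := opNorm_coe_le_one W
  have := opNorm_nonneg A
  have := opNorm_nonneg (V.1 * A)
  nlinarith

theorem norm_apply_le_opNorm (A : Matrix (Fin 2) (Fin 2) ℂ) (i j : Fin 2) :
    ‖A i j‖ ≤ opNorm A := by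
  have h := (Matrix.toEuclideanCLM (n := Fin 2) (𝕜 := ℂ) A).le_opNorm (EuclideanSpace.single j 1)
  rw [PiLp.norm_single, norm_one, mul_one] at h
  refine le_trans ?_ h
  have h2 := PiLp.norm_apply_le
    (Matrix.toEuclideanCLM (n := Fin 2) (𝕜 := ℂ) A (EuclideanSpace.single j 1)) i
  simpa [Matrix.ofLp_toEuclideanCLM] using h2

theorem opNorm_le_sum (A : Matrix (Fin 2) (Fin 2) ℂ) :
    opNorm A ≤ ‖A 0 0‖ + ‖A 0 1‖ + ‖A 1 0‖ + ‖A 1 1‖ := by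
  refine ContinuousLinearMap.opNorm_le_bound _ (by positivity) fun v => ?_
  set w := Matrix.toEuclideanCLM (n := Fin 2) (𝕜 := ℂ) A v with hw
  have hv0 := PiLp.norm_apply_le v 0
  have hv1 := PiLp.norm_apply_le v 1
  have e : ∀ i, w i = A i 0 * v 0 + A i 1 * v 1 := fun i => by
    simp [hw, Matrix.ofLp_toEuclideanCLM, Matrix.mulVec, dotProduct, Fin.sum_univ_two]
  have hwi : ∀ i, ‖w i‖ ≤ (‖A i 0‖ + ‖A i 1‖) * ‖v‖ := fun i => by
    rw [e]
    refine (norm_add_le _ _).trans ?_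
    rw [norm_mul, norm_mul, add_mul]
    gcongr
  have hw' : ‖w‖ ≤ ‖w 0‖ + ‖w 1‖ := by
    rw [EuclideanSpace.norm_eq, Fin.sum_univ_two, Real.sqrt_le_left (by positivity)]
    nlinarith [norm_nonneg (w 0), norm_nonneg (w 1)]
  linarith [hwi 0, hwi 1]

/-- If the first column of `V` is close to that of `e^{iaσ_z}`, then `V` in the eigenbasis of `σ_x`,
times its mirror image, is close to `e^{2iaσ_x}`. -/
theorem opNorm_mul_mirror_sub_le (V : SU2) (a : ℝ) :
    opNorm (((eigenbasisX * V * eigenbasisX⁻¹) * (eigenbasisX * V * eigenbasisX⁻¹).mirror).1 -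
      (rotX (2 * a)).1) ≤ 4 * (‖V.1 0 0 - phase a‖ + ‖V.1 1 0‖) := by
  set W := eigenbasisX * V * eigenbasisX⁻¹ with hW
  have hR : rotX a = eigenbasisX * rotZ a * eigenbasisX⁻¹ := by
    rw [← rotX_mul_eigenbasisX, mul_inv_cancel_right]
  have hz : (rotZ a).1 = !![phase a, 0; 0, conj (phase a)] := by
    rw [conj_phase_eq, phase_eq]; rfl
  have hd : ‖conj (V.1 0 0) - conj (phase a)‖ = ‖V.1 0 0 - phase a‖ := by
    rw [← map_sub, Complex.norm_conj]
  have h1 : opNorm (W.1 - (rotX a).1) ≤ 2 * (‖V.1 0 0 - phase a‖ + ‖V.1 1 0‖) := by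
    have : W.1 - (rotX a).1 = eigenbasisX.1 * (V.1 - (rotZ a).1) * (eigenbasisX⁻¹ : SU2).1 := by
      rw [hW, hR, Submonoid.coe_mul, Submonoid.coe_mul, Submonoid.coe_mul, Submonoid.coe_mul,
        Matrix.mul_sub, Matrix.sub_mul]
    rw [this]
    refine (opNorm_conj_le _ _ _).trans ((opNorm_le_sum _).trans (le_of_eq ?_))
    simp [hz, V.apply_one_one.1, V.apply_one_one.2, hd]
    ring
  have h2 : opNorm (W.mirror.1 - (rotX a).1) ≤ 2 * (‖V.1 0 0 - phase a‖ + ‖V.1 1 0‖) := by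
    have : W.mirror.1 - (rotX a).1 = (eigenbasisX⁻¹ : SU2).mirror.1 *
        (V.mirror.1 - (rotZ a).mirror.1) * eigenbasisX.mirror.1 := by
      rw [← mirror_rotX, hW, hR]
      simp only [SU2.mirror_mul, Submonoid.coe_mul, Matrix.mul_sub, Matrix.sub_mul, Matrix.mul_assoc]
    rw [this]
    refine (opNorm_conj_le _ _ _).trans ((opNorm_le_sum _).trans (le_of_eq ?_))
    simp [SU2.coe_mirror, hz, V.apply_one_one.1, V.apply_one_one.2, hd]
    ring
  -- Telescoping with `e^{2iaσ_x} = (e^{iaσ_x})²`: since the unitaries have norm at most one, the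
  -- two errors add.
  have hsplit : (W * W.mirror).1 - (rotX (2 * a)).1 =
      (W.1 - (rotX a).1) * W.mirror.1 + (rotX a).1 * (W.mirror.1 - (rotX a).1) := by
    rw [two_mul, ← rotX_mul_rotX, Submonoid.coe_mul, Submonoid.coe_mul, Matrix.sub_mul,
      Matrix.mul_sub]
    abel
  rw [hsplit]
  have h3 := opNorm_mul_le (W.1 - (rotX a).1) W.mirror.1
  have h4 := opNorm_mul_le (rotX a).1 (W.mirror.1 - (rotX a).1)
  have h5 := mul_le_of_le_one_right (opNorm_nonneg (W.1 - (rotX a).1)) (opNorm_coe_le_one W.mirror)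
  have h6 := mul_le_of_le_one_left (opNorm_nonneg (W.mirror.1 - (rotX a).1))
    (opNorm_coe_le_one (rotX a))
  linarith [opNorm_add_le ((W.1 - (rotX a).1) * W.mirror.1)
    ((rotX a).1 * (W.mirror.1 - (rotX a).1))]

/-! ### Choice of the degree and assembly -/

/-- The degree that suffices in the truncation of the power series. -/
theorem exists_degree {δ ε : ℝ} (hδ0 : 0 < δ) (hδ1 : δ ≤ 1) (hε0 : 0 < ε) (hε1 : ε ≤ 1 / 2) :
    ∃ K : ℕ, 1 ≤ K ∧ 8 * K * (1 - δ) ^ (2 * K) ≤ (ε / 16) ^ 2 ∧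
      (K : ℝ) ≤ 11 * (δ⁻¹ * Real.log (ε ^ (-2 : ℝ) * δ ^ (-(1 / 4) : ℝ))) := by
  have hL : Real.log (ε ^ (-2 : ℝ) * δ ^ (-(1 / 4) : ℝ)) =
      -2 * Real.log ε - 1 / 4 * Real.log δ := by
    rw [Real.log_mul (by positivity) (by positivity), Real.log_rpow hε0, Real.log_rpow hδ0]
    ring
  set L := Real.log (ε ^ (-2 : ℝ) * δ ^ (-(1 / 4) : ℝ))
  have hlogε : Real.log ε ≤ -Real.log 2 := by
    rw [← Real.log_inv]
    exact Real.log_le_log hε0 (by linarith)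
  have hlogδ : Real.log δ ≤ 0 := Real.log_nonpos hδ0.le hδ1
  have hlog2 := Real.log_two_gt_d9
  have hlog : Real.log (2048 / (ε ^ 2 * δ)) = 11 * Real.log 2 - 2 * Real.log ε - Real.log δ := by
    rw [Real.log_div (by norm_num) (by positivity), Real.log_mul (by positivity) hδ0.ne',
      Real.log_pow, show (2048 : ℝ) = 2 ^ 11 by norm_num, Real.log_pow]
    push_cast
    ring
  -- Since `ε ≤ 1/2`, the term `-18 log ε` dominates `11 log 2`.
  have hM : Real.log (2048 / (ε ^ 2 * δ)) ≤ 10 * L := by linarith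
  have hM0 : 0 < Real.log (2048 / (ε ^ 2 * δ)) := by linarith
  have hδinv : 1 ≤ δ⁻¹ := (one_le_inv₀ hδ0).2 hδ1
  have hδL : 1 ≤ δ⁻¹ * L := by nlinarith
  -- `2048 = 8 · 16²`. Of the two factors `(1 - δ)^K ≤ e^{-Kδ}`, one supplies `ε²δ/2048` and the
  -- other absorbs `Kδ` through `te^{-t} ≤ 1`.
  set K := ⌈δ⁻¹ * Real.log (2048 / (ε ^ 2 * δ))⌉₊ with hK
  have hKlow : δ⁻¹ * Real.log (2048 / (ε ^ 2 * δ)) ≤ K := Nat.le_ceil _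
  have hKup : (K : ℝ) < δ⁻¹ * Real.log (2048 / (ε ^ 2 * δ)) + 1 :=
    Nat.ceil_lt_add_one (by positivity)
  refine ⟨K, Nat.one_le_ceil_iff.2 (by positivity), ?_, ?_⟩
  · have e1 : (1 - δ) ^ K ≤ Real.exp (-(K * δ)) := by
      rw [show -(K * δ) = (K : ℝ) * -δ by ring, Real.exp_nat_mul]
      exact pow_le_pow_left₀ (by linarith) (Real.one_sub_le_exp_neg δ) _
    have e2 : Real.exp (-(K * δ)) ≤ ε ^ 2 * δ / 2048 := by
      rw [← Real.le_log_iff_exp_le (by positivity), ← inv_div, Real.log_inv, neg_le_neg_iff]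
      rwa [inv_mul_le_iff₀ hδ0, mul_comm δ] at hKlow
    have e3 : K * δ * Real.exp (-(K * δ)) ≤ 1 := by
      rw [Real.exp_neg, ← div_eq_mul_inv, div_le_one (Real.exp_pos _)]
      linarith [Real.add_one_le_exp (K * δ)]
    have hK0 : (0 : ℝ) ≤ K := K.cast_nonneg
    have h0 : 0 ≤ (1 - δ) ^ K := pow_nonneg (by linarith) _
    have e4 : (1 - δ) ^ (2 * K) ≤ Real.exp (-(K * δ)) * (ε ^ 2 * δ / 2048) := by
      rw [two_mul, pow_add]
      exact mul_le_mul e1 (e1.trans e2) h0 (Real.exp_nonneg _)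
    calc 8 * K * (1 - δ) ^ (2 * K) ≤ 8 * K * (Real.exp (-(K * δ)) * (ε ^ 2 * δ / 2048)) := by
          gcongr
      _ = (K * δ * Real.exp (-(K * δ))) * (ε / 16) ^ 2 := by ring
      _ ≤ (ε / 16) ^ 2 := mul_le_of_le_one_left (by positivity) e3
  · have : δ⁻¹ * Real.log (2048 / (ε ^ 2 * δ)) ≤ δ⁻¹ * (10 * L) := by gcongr
    linarith

theorem arccos_div_mem {m : ℕ} (hm : 1 ≤ m) (x : ℝ) :
    Real.arccos x / m ∈ Set.Icc 0 Real.pi :=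
  ⟨div_nonneg (Real.arccos_nonneg x) m.cast_nonneg,
    (div_le_self (Real.arccos_nonneg x) (by exact_mod_cast hm)).trans (Real.arccos_le_pi x)⟩

theorem eval_T_chebyshevInv {m : ℕ} (hm : 1 ≤ m) {x : ℝ} (hx : x ∈ Set.Icc (-1 : ℝ) 1) :
    (Polynomial.Chebyshev.T ℝ (m : ℤ)).eval (chebyshevInv m x) = x := by
  have hm0 : (m : ℝ) ≠ 0 := by positivity
  rw [chebyshevInv, Polynomial.Chebyshev.T_real_cos, Int.cast_natCast, mul_div_cancel₀ _ hm0,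
    Real.cos_arccos hx.1 hx.2]

/-- The exponent is `1/(2m)` because the mirror product doubles the angle. The accuracy of `f` must
be of order `ε²`, because normalization controls only `|g|²`, of the order of the error in `f`. -/
theorem exists_gadget_chebyshevInv {m : ℕ} (hm : 1 ≤ m) {δ ε : ℝ} (hδ0 : 0 < δ) (hδ1 : δ ≤ 1)
    (hε0 : 0 < ε) (hε1 : ε ≤ 1 / 2) {K : ℕ} (hK : 1 ≤ K)
    (hKε : 8 * K * (1 - δ) ^ (2 * K) ≤ (ε / 16) ^ 2) :
    ∃ G : SingleQubitGadget 1 1,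
      ApproxEmbeds G ε (chebyshevInv m) (Set.Icc (-1 + δ) (1 - δ)) ∧
      G.depth ≤ 22 * K ∧ G.cost 0 0 ≤ 22 * K := by
  have hm' : (1 : ℝ) ≤ m := by exact_mod_cast hm
  have hs0 : (0 : ℝ) < 1 / (2 * m) := by positivity
  have hs1 : (1 : ℝ) / (2 * m) ≤ 1 := by rw [div_le_one (by positivity)]; linarith
  obtain ⟨f, g, hf, hg, hfg, happ⟩ := exists_isTrigPoly_approx_phase hs0 hs1 hK
  obtain ⟨c, hc1, hc2, hc3⟩ := exists_circuit_column hf hg hfg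
  refine ⟨mirrorGadget (.fixed eigenbasisX :: (c ++ [.fixed eigenbasisX⁻¹])), ?_, ?_, ?_⟩
  · intro x hx
    set θ := Real.arccos x with hθ
    have hcos : Real.cos θ = x := Real.cos_arccos (by linarith [hx.1]) (by linarith [hx.2])
    have hev : Circuit.eval (.fixed eigenbasisX :: (c ++ [.fixed eigenbasisX⁻¹]))
        (fun _ => rotX θ) = eigenbasisX * (c.eval fun _ => rotX θ) * eigenbasisX⁻¹ := by
      simp [Circuit.eval, Gate.eval, mul_assoc]
    have harc : Real.arccos (chebyshevInv m x) = 2 * (1 / (2 * m) * θ) := by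
      rw [chebyshevInv, Real.arccos_cos (arccos_div_mem hm x).1 (arccos_div_mem hm x).2, ← hθ]
      field_simp
    have he := (happ (1 - δ) θ (by linarith) ⟨Real.arccos_nonneg x, Real.arccos_le_pi x⟩
      (by rw [hcos, abs_le]; constructor <;> linarith [hx.1, hx.2])).trans hKε
    rw [mirrorGadget_response, ← hθ, hev, harc]
    refine (opNorm_mul_mirror_sub_le _ _).trans ?_
    rw [(hc3 θ).1, (hc3 θ).2]
    have hlow : 1 - (ε / 16) ^ 2 ≤ ‖f θ‖ := by
      have := norm_sub_norm_le (phase (1 / (2 * m) * θ)) (f θ)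
      rw [norm_phase, norm_sub_rev] at this
      linarith
    have hg2 : ‖g θ‖ ^ 2 ≤ 2 * (ε / 16) ^ 2 := by
      nlinarith [hfg θ, norm_nonneg (f θ), sq_nonneg (‖f θ‖ - 1)]
    have hg1 : ‖g θ‖ ≤ 2 * (ε / 16) :=
      abs_le_of_sq_le_sq' (by nlinarith [sq_nonneg ε]) (by positivity) |>.2
    -- `4((ε/16)² + 2ε/16) ≤ ε`.
    nlinarith
  -- The column circuit of degree `2K` has at most `8K + 1` gates; two basis changes and the
  -- doubling give `16K + 6 ≤ 22K`.
  · rw [mirrorGadget_depth]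
    simp only [List.length_cons, List.length_append, List.length_nil]
    omega
  · rw [mirrorGadget_cost]
    simp only [List.map_cons, List.map_append, List.sum_cons, List.sum_append, Gate.queryCount,
      List.map_nil, List.sum_nil]
    omega

theorem ApproxEmbeds.approxAchieves {G : SingleQubitGadget 1 1} {ε : ℝ} {f : ℝ → ℝ} {D : Set ℝ}
    (h : ApproxEmbeds G ε f D) (hf : ∀ x ∈ D, f x ∈ Set.Icc (-1) 1) : ApproxAchieves G ε f D := by
  intro x hx
  refine le_trans ?_ ((norm_apply_le_opNorm _ 0 0).trans (h x hx))
  rw [Matrix.sub_apply]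
  have : (rotX (Real.arccos (f x))).1 0 0 = (f x : ℂ) := by
    simp [-Complex.ofReal_cos, rotX, rotXMatrix, Real.cos_arccos (hf x hx).1 (hf x hx).2]
  rw [this]

theorem mainTheorem5 :
    -- The functions `T_{2^n}⁻¹` are right-inverses of the Chebyshev polynomials `T_{2^n}`.
    (∀ n : ℕ, ∀ x ∈ Set.Icc (-1 : ℝ) 1, chebyshevInv (2 ^ n) x ∈ Set.Icc (-1 : ℝ) 1 ∧
      (Polynomial.Chebyshev.T ℝ ((2 ^ n : ℕ) : ℤ)).eval (chebyshevInv (2 ^ n) x) = x) ∧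
    -- They are approximately achieved, with an absolute constant `C` in the bounds.
    ∃ C : ℝ, 0 < C ∧ ∀ (n : ℕ) (δ ε : ℝ), 0 < δ → δ ≤ 1 → 0 < ε → ε ≤ 1 / 2 →
      ∃ G : SingleQubitGadget 1 1,
        ApproxAchieves G ε (chebyshevInv (2 ^ n)) (Set.Icc (-1 + δ) (1 - δ)) ∧
        ApproxEmbeds G ε (chebyshevInv (2 ^ n)) (Set.Icc (-1 + δ) (1 - δ)) ∧
        (G.depth : ℝ) ≤ C * (δ⁻¹ * Real.log (ε ^ (-2 : ℝ) * δ ^ (-(1 / 4) : ℝ))) ∧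
        (G.cost 0 0 : ℝ) ≤ C * (δ⁻¹ * Real.log (ε ^ (-2 : ℝ) * δ ^ (-(1 / 4) : ℝ))) := by
  -- `22` gates per unit of `K`, times the factor `11` in the bound on `K`.
  refine ⟨fun n x hx => ⟨Real.cos_mem_Icc _, ?_⟩, 22 * 11, by norm_num,
    fun n δ ε hδ0 hδ1 hε0 hε1 => ?_⟩
  · exact_mod_cast eval_T_chebyshevInv Nat.one_le_two_pow hx
  · obtain ⟨K, hK, hKε, hKle⟩ := exists_degree hδ0 hδ1 hε0 hε1
    obtain ⟨G, hG, hdepth, hcost⟩ :=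
      exists_gadget_chebyshevInv (Nat.one_le_two_pow (n := n)) hδ0 hδ1 hε0 hε1 hK hKε
    have hd : (G.depth : ℝ) ≤ 22 * K := by exact_mod_cast hdepth
    have hc : (G.cost 0 0 : ℝ) ≤ 22 * K := by exact_mod_cast hcost
    exact ⟨G, hG.approxAchieves fun x _ => Real.cos_mem_Icc _, hG, by linarith, by linarith⟩
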